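/- Let $\delta,\lambda\in\mathbb{R}$ with $\lambda>0$. Let $H^2_{imm}$ be the set of curves $\gamma\in H^2([0,2\pi];\mathbb{R}^2)$ with $\partial_x\gamma\neq 0$ on $[0,2\pi]$, $\gamma(0)=\gamma(2\pi)$ and $\partial_x\gamma(0)=\partial_x\gamma(2\pi)$, and let $H^1_{per}$ be the set of $\eta\in H^1([0,2\pi];\mathbb{R}^2)$ with $\eta(0)=\eta(2\pi)$. For $\gamma\in H^2_{imm}$ write $\partial_s=|\partial_x\gamma|^{-1}\partial_x$, $\int_\gamma f\,ds=\int_0^{2\pi}f\,|\partial_x\gamma|\,dx$, $\tau=\partial_s\gamma$, $\nu=J\tau$ with $J$ the counterclockwise rotation by $\pi/2$, $\kappa=\langle\partial_s\tau,\nu\rangle$, $L(\gamma)=\int_0^{2\pi}|\partial_x\gamma|\,dx$, and for $\eta\in H^1_{per}$ write $\operatorname{div}_\gamma\eta=\langle\partial_s\eta,\tau\rangle$ and $\nabla_\gamma\eta=\partial_s\eta\otimes\tau$ (with the Euclidean matrix norm). Define $$E_{LM}(\gamma,\eta)=\frac12\int_\gamma(\kappa+\delta\operatorname{div}_\gamma\eta)^2\,ds+\frac{\lambda}{2}\int_\gamma|\nabla_\gamma\eta|^2\,ds+L(\gamma).$$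 Then $E_{LM}$ attains its minimum over all pairs $(\gamma,\eta)\in H^2_{imm}\times H^1_{per}$ with $\int_0^{2\pi}\gamma\,dx=0$ and $\int_0^{2\pi}\eta\,dx=0$; moreover, a minimizing pair can be chosen with $\gamma$ parametrized proportionally to arc length, that is, $|\partial_x\gamma(x)|=L(\gamma)/2\pi$ for all $x\in[0,2\pi]$. -/

import Mathlib

open MeasureTheory Set
open scoped ContDiff

namespace LM

noncomputable section

/-- The Euclidean plane. -/
abbrev Plane : Type := EuclideanSpace ℝ (Fin 2)

/-- The parameter interval `[0, 2π]`. Functions on it are represented by functions on `ℝ`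
whose values outside the interval play no role. -/
def I : Set ℝ := Icc 0 (2 * Real.pi)

/-- `∂ₓ f`, the derivative of `f` on `[0, 2π]`, one-sided at the two end points. For the continuous
representative of an `H¹` function it exists almost everywhere and represents the weak derivative;
for the continuous representative of an `H²` function it exists everywhere and is continuous. -/
def dx (f : ℝ → Plane) : ℝ → Plane := derivWithin f I

/-- `g` is a weak derivative of `f` on the open interval `(0, 2π)`. -/
def IsWeakDeriv (f g : ℝ → Plane) : Prop :=
  ∀ φ : ℝ → ℝ, ContDiff ℝ ∞ φ → HasCompactSupport φ → tsupport φ ⊆ Ioo 0 (2 * Real.pi) →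
    ∫ x in 0..(2 * Real.pi), deriv φ x • f x = -∫ x in 0..(2 * Real.pi), φ x • g x

/-- `f ∈ H¹([0, 2π]; ℝ²)`, for the continuous representative: the weak derivative of `f`
(represented by the almost everywhere existing pointwise derivative) lies in `L²`. That `f` itself
lies in `L²` follows from its continuity. -/
def MemH1 (f : ℝ → Plane) : Prop :=
  ContinuousOn f I ∧ MemLp (dx f) 2 (volume.restrict I) ∧ IsWeakDeriv f (dx f)

/-- `f ∈ H²([0, 2π]; ℝ²)`: both `f` and its derivative are of class `H¹`. -/
def MemH2 (f : ℝ → Plane) : Prop := MemH1 f ∧ MemH1 (dx f)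

/-- `H¹_per`: the `H¹` functions with `η(0) = η(2π)`. -/
def MemH1per (η : ℝ → Plane) : Prop := MemH1 η ∧ η 0 = η (2 * Real.pi)

/-- `H²_imm`: regular `H²` curves with `γ(0) = γ(2π)` and `∂ₓγ(0) = ∂ₓγ(2π)`. -/
def MemH2imm (γ : ℝ → Plane) : Prop :=
  MemH2 γ ∧ (∀ x ∈ I, dx γ x ≠ 0) ∧ γ 0 = γ (2 * Real.pi) ∧ dx γ 0 = dx γ (2 * Real.pi)

/-- The arc length derivative `∂ₛ f = |∂ₓγ|⁻¹ ∂ₓ f` along `γ`. -/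
def ds (γ f : ℝ → Plane) : ℝ → Plane := fun x => ‖dx γ x‖⁻¹ • dx f x

/-- The unit tangent `τ = ∂ₛγ`. -/
def tangent (γ : ℝ → Plane) : ℝ → Plane := ds γ γ

/-- The counterclockwise rotation by `π/2`. -/
def rotJ (v : Plane) : Plane := !₂[-v 1, v 0]

/-- The unit normal `ν = J τ`. -/
def normal (γ : ℝ → Plane) : ℝ → Plane := fun x => rotJ (tangent γ x)

/-- The oriented curvature, `∂ₛτ = κ ν`. -/
def curvature (γ : ℝ → Plane) : ℝ → ℝ := fun x => inner ℝ (ds γ (tangent γ) x) (normal γ x)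

/-- `∇_γ η = ∂ₛη ⊗ τ`, the matrix whose rows are the tangential gradients of the components. -/
def gradCurve (γ η : ℝ → Plane) : ℝ → Matrix (Fin 2) (Fin 2) ℝ :=
  fun x => Matrix.of fun i j => ds γ η x i * tangent γ x j

/-- `div_γ η = ⟨∂ₛη, τ⟩`. -/
def divCurve (γ η : ℝ → Plane) : ℝ → ℝ := fun x => inner ℝ (ds γ η x) (tangent γ x)

/-- The integral `∫_γ f ds = ∫₀^{2π} f |∂ₓγ| dx`. -/
def lineIntegral (γ : ℝ → Plane) (f : ℝ → ℝ) : ℝ :=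
  ∫ x in 0..(2 * Real.pi), f x * ‖dx γ x‖

/-- The length of `γ`. -/
def curveLength (γ : ℝ → Plane) : ℝ := ∫ x in 0..(2 * Real.pi), ‖dx γ x‖

/-- The squared Euclidean (Frobenius) norm of a matrix. -/
def matNormSq (A : Matrix (Fin 2) (Fin 2) ℝ) : ℝ := ∑ i, ∑ j, A i j ^ 2

/-- The energy
`E_LM(γ, η) = ½ ∫_γ (κ + δ div_γ η)² ds + (λ/2) ∫_γ |∇_γ η|² ds + L(γ)`.
On `H²_imm × H¹_per` both integrands are integrable. -/
def energy (δ lam : ℝ) (γ η : ℝ → Plane) : ℝ :=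
  1 / 2 * lineIntegral γ (fun x => (curvature γ x + δ * divCurve γ η x) ^ 2)
    + lam / 2 * lineIntegral γ (fun x => matNormSq (gradCurve γ η x))
    + curveLength γ

/-- The admissible pairs: `γ ∈ H²_imm` and `η ∈ H¹_per`, both of vanishing mean value. -/
def Admissible (γ η : ℝ → Plane) : Prop :=
  MemH2imm γ ∧ MemH1per η ∧
    (∫ x in 0..(2 * Real.pi), γ x) = 0 ∧ (∫ x in 0..(2 * Real.pi), η x) = 0

end

end LM

/-! The minimum is found explicitly, without compactness, by a pointwise bound that is sharp on
circles. Write d for the divergence of η. Cauchy–Schwarz gives d² ≤ |∇η|², and minimizing the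
quadratic ½(κ + δd)² + (λ/2)d² over d gives R²κ², where R² = λ / (2(λ + δ²)), attained at d = -δκ/(λ
+ δ²). Adding the density 1 of the length, R²κ² + 1 ≥ 2R|κ|. Integrating along γ and applying
Fenchel's inequality ∫|κ| ds ≥ 2π gives energy at least 4πR (`LM.four_pi_radius_le_energy`). All the
inequalities are equalities for the circle of radius R with η a multiple of the position vector,
which is already parametrized proportionally to arc length.

The analytic work is Fenchel's inequality at H² regularity. A du Bois-Reymond argument turns weak
derivatives into primitives, so the velocity is absolutely continuous. Read as a complex function v,
it has an angle θ, the primitive of Im(v'/v). If the total variation of θ were below 2π, the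
tangents would lie in an open half plane and the curve could not close. -/

/-! ### Absolute continuity and the complex logarithm along a curve -/

/-- Postcomposition with a function that is Lipschitz on the range preserves absolute continuity. -/
theorem AbsolutelyContinuousOnInterval.lipschitzOnWith_comp {X Y : Type*} [PseudoMetricSpace X]
    [PseudoMetricSpace Y] {f : ℝ → X} {g : X → Y} {a b : ℝ} {s : Set X} {K : NNReal}
    (hf : AbsolutelyContinuousOnInterval f a b) (hg : LipschitzOnWith K g s)
    (hs : MapsTo f (uIcc a b) s) : AbsolutelyContinuousOnInterval (fun x => g (f x)) a b := by
  rw [absolutelyContinuousOnInterval_iff] at hf ⊢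
  intro ε hε
  -- Dividing by K + 1 instead of K covers K = 0 and makes the final estimate strict.
  obtain ⟨d, hd, h⟩ := hf (ε / (K + 1)) (by positivity)
  refine ⟨d, hd, fun E hE hE' => ?_⟩
  have h1 := h E hE hE'
  calc ∑ i ∈ Finset.range E.1, dist (g (f (E.2 i).1)) (g (f (E.2 i).2))
      ≤ ∑ i ∈ Finset.range E.1, K * dist (f (E.2 i).1) (f (E.2 i).2) :=
        Finset.sum_le_sum fun i hi =>
          hg.dist_le_mul _ (hs (hE.left i hi).left) _ (hs (hE.left i hi).right)
    _ = K * ∑ i ∈ Finset.range E.1, dist (f (E.2 i).1) (f (E.2 i).2) := by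
        rw [Finset.mul_sum]
    _ ≤ K * (ε / (K + 1)) := by gcongr
    _ < (K + 1) * (ε / (K + 1)) := by gcongr; linarith
    _ = ε := by field

theorem absolutelyContinuousOnInterval_const {X : Type*} [PseudoMetricSpace X] (c : X) (a b : ℝ) :
    AbsolutelyContinuousOnInterval (fun _ => c) a b :=
  ((LipschitzWith.const c).lipschitzOnWith (s := uIcc a b)).absolutelyContinuousOnInterval

theorem IntervalIntegrable.absolutelyContinuousOnInterval_integral_complex {h : ℝ → ℂ} {a b : ℝ}
    (hh : IntervalIntegrable h volume a b) :
    AbsolutelyContinuousOnInterval (fun x => ∫ t in a..x, h t) a b := by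
  have hre : IntervalIntegrable (fun t => (h t).re) volume a b := ⟨hh.1.re, hh.2.re⟩
  have him : IntervalIntegrable (fun t => (h t).im) volume a b := ⟨hh.1.im, hh.2.im⟩
  have h1 := hre.absolutelyContinuousOnInterval_intervalIntegral (c := a) (by simp)
  have h2 := him.absolutelyContinuousOnInterval_intervalIntegral (c := a) (by simp)
  have h3 := (h1.smul (absolutelyContinuousOnInterval_const (1 : ℂ) a b)).add
    (h2.smul (absolutelyContinuousOnInterval_const Complex.I a b))
  have key : ∀ x ∈ uIcc a b, (∫ t in a..x, h t) =
      (∫ t in a..x, (h t).re) • (1 : ℂ) + (∫ t in a..x, (h t).im) • Complex.I := by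
    intro x hx
    have hs : uIcc a x ⊆ uIcc a b := uIcc_subset_uIcc_left hx
    have e1 : IntervalIntegrable (fun t => (h t).re • (1 : ℂ)) volume a x :=
      ⟨(hre.mono_set hs).1.smul_const _, (hre.mono_set hs).2.smul_const _⟩
    have e2 : IntervalIntegrable (fun t => (h t).im • Complex.I) volume a x :=
      ⟨(him.mono_set hs).1.smul_const _, (him.mono_set hs).2.smul_const _⟩
    rw [← intervalIntegral.integral_smul_const, ← intervalIntegral.integral_smul_const,
      ← intervalIntegral.integral_add e1 e2]
    refine intervalIntegral.integral_congr fun t _ => ?_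
    simp [Complex.re_add_im]
  rw [absolutelyContinuousOnInterval_iff] at h3 ⊢
  intro ε hε
  obtain ⟨d, hd, H⟩ := h3 ε hε
  refine ⟨d, hd, fun E hE hE' => ?_⟩
  refine lt_of_eq_of_lt (Finset.sum_congr rfl fun i hi => ?_) (H E hE hE')
  rw [key _ (hE.left i hi).left, key _ (hE.left i hi).right]
  rfl

/-- A nonvanishing absolutely continuous complex function is the exponential of the primitive of
its logarithmic derivative. -/
theorem eq_mul_exp_integral_logDeriv {a b : ℝ} (hab : a ≤ b) {v h : ℝ → ℂ}
    (hh : IntervalIntegrable h volume a b) (hv : ∀ x ∈ Icc a b, v x = v a + ∫ t in a..x, h t)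
    (hvc : ContinuousOn v (Icc a b)) (hv0 : ∀ x ∈ Icc a b, v x ≠ 0) :
    IntervalIntegrable (fun t => h t / v t) volume a b ∧
      ∀ x ∈ Icc a b, v x = v a * Complex.exp (∫ t in a..x, h t / v t) := by
  have hq : IntervalIntegrable (fun t => h t / v t) volume a b := by
    simp_rw [div_eq_mul_inv]
    exact hh.mul_continuousOn (by rw [uIcc_of_le hab]; exact hvc.inv₀ hv0)
  refine ⟨hq, ?_⟩
  set G : ℝ → ℂ := fun x => ∫ t in a..x, h t / v t with hG
  have hGac : AbsolutelyContinuousOnInterval G a b :=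
    hq.absolutelyContinuousOnInterval_integral_complex
  have hVac : AbsolutelyContinuousOnInterval (fun x => v a + ∫ t in a..x, h t) a b :=
    (absolutelyContinuousOnInterval_const (v a) a b).add
      hh.absolutelyContinuousOnInterval_integral_complex
  -- The exponential is only locally Lipschitz, but G stays in a compact ball.
  obtain ⟨C, hC⟩ := hGac.exists_bound
  have hexp : ContDiff ℝ 1 (fun z : ℂ => Complex.exp (-z)) :=
    Complex.contDiff_exp.comp contDiff_neg
  obtain ⟨K, hK⟩ := hexp.contDiffOn.exists_lipschitzOnWith (by decide)
    (convex_closedBall (0 : ℂ) C) (isCompact_closedBall (0 : ℂ) C)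
  have hEac : AbsolutelyContinuousOnInterval (fun x => Complex.exp (-G x)) a b :=
    hGac.lipschitzOnWith_comp hK fun x hx => by simpa using hC x hx
  have hPac := hEac.smul hVac
  -- The product exp(-G) v has derivative exp(-G) (h - (h/v) v) = 0 almost everywhere; absolute
  -- continuity makes it constant.
  obtain ⟨c, hc⟩ := hPac.const_of_ae_hasDerivAt_zero (by
    filter_upwards [hq.ae_hasDerivAt_integral, hh.ae_hasDerivAt_integral] with x h1 h2 hx
    have hx' : x ∈ Icc a b := by rwa [uIcc_of_le hab] at hx
    have d1 := (h1 hx a (by simp)).neg.cexp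
    have d2 := (h2 hx a (by simp)).const_add (v a)
    have d3 := d1.mul d2
    refine d3.congr_deriv ?_
    rw [← hv x hx']
    have := hv0 x hx'
    field_simp
    ring)
  rw [uIcc_of_le hab] at hc
  intro x hx
  have e1 := hc x hx
  have e2 := hc a ⟨le_rfl, hab⟩
  simp only [Pi.smul_apply', smul_eq_mul, ← hv x hx, hG, intervalIntegral.integral_same, neg_zero,
    Complex.exp_zero, one_mul, add_zero] at e1 e2
  rw [e2, ← e1, mul_right_comm, ← Complex.exp_add]
  simp

/-! ### Fenchel's inequality for absolutely continuous velocities -/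

/-- Fenchel's inequality: the total curvature of a closed regular plane curve with absolutely
continuous velocity `v` is at least `2π`. -/
theorem two_pi_le_integral_abs_im_logDeriv {a b : ℝ} (hab : a < b) {v h : ℝ → ℂ}
    (hh : IntervalIntegrable h volume a b) (hv : ∀ x ∈ Icc a b, v x = v a + ∫ t in a..x, h t)
    (hvc : ContinuousOn v (Icc a b)) (hv0 : ∀ x ∈ Icc a b, v x ≠ 0)
    (hper : v b = v a) (hclosed : ∫ x in a..b, v x = 0) :
    2 * Real.pi ≤ ∫ x in a..b, |(h x / v x).im| := by
  obtain ⟨hq, hexp⟩ := eq_mul_exp_integral_logDeriv hab.le hh hv hvc hv0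
  set G : ℝ → ℂ := fun x => ∫ t in a..x, h t / v t with hG
  set θ : ℝ → ℝ := fun x => (G x).im with hθ
  have hGc : ContinuousOn G (Icc a b) := by
    rw [← uIcc_of_le hab.le]
    exact hq.absolutelyContinuousOnInterval_integral_complex.continuousOn
  have hθc : ContinuousOn θ (Icc a b) := Complex.continuous_im.comp_continuousOn hGc
  have hψ : IntervalIntegrable (fun t => (h t / v t).im) volume a b := ⟨hq.1.im, hq.2.im⟩
  have hψs : ∀ x ∈ Icc a b, ∀ y ∈ Icc a b,
      IntervalIntegrable (fun t => (h t / v t).im) volume x y := fun x hx y hy =>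
    hψ.mono_set (by rw [uIcc_of_le hab.le]; exact uIcc_subset_Icc hx hy)
  have hθi : ∀ x ∈ Icc a b, θ x = ∫ t in a..x, (h t / v t).im := by
    intro x hx
    have hqx : IntervalIntegrable (fun t => h t / v t) volume a x :=
      hq.mono_set (by rw [uIcc_of_le hab.le]; exact uIcc_subset_Icc ⟨le_rfl, hab.le⟩ hx)
    exact (Complex.imCLM.intervalIntegral_comp_comm hqx).symm
  have ha : a ∈ Icc a b := ⟨le_rfl, hab.le⟩
  have hb : b ∈ Icc a b := ⟨hab.le, le_rfl⟩
  have hvar : ∀ x ∈ Icc a b, ∀ y ∈ Icc a b, x ≤ y →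
      |θ y - θ x| ≤ ∫ t in x..y, |(h t / v t).im| := by
    intro x hx y hy hxy
    rw [hθi x hx, hθi y hy, intervalIntegral.integral_interval_sub_left (hψs a ha y hy)
      (hψs a ha x hx)]
    exact intervalIntegral.abs_integral_le_integral_abs hxy
  by_contra! hlt
  have hθa : θ a = 0 := by simp [hθ, hG]
  -- Periodicity of v makes θ b an integer multiple of 2π, and the assumed bound on the variation
  -- leaves only 0.
  have hθb : θ b = 0 := by
    have h1 := hexp b hb
    rw [hper] at h1
    have h2 : Complex.exp (G b) = 1 := by
      have := hv0 a ha
      field_simp at h1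
      exact h1.symm
    obtain ⟨n, hn⟩ := Complex.exp_eq_one_iff.1 h2
    have h3 : θ b = n * (2 * Real.pi) := by simp [hθ, hn]
    have h4 := hvar a ha b hb hab.le
    rw [hθa, sub_zero, h3, abs_mul, abs_of_pos Real.two_pi_pos] at h4
    have h5 : |(n : ℝ)| < 1 := by
      by_contra! h6
      nlinarith [Real.pi_pos]
    have h6 : n = 0 := by
      rw [← Int.cast_abs] at h5
      exact Int.abs_lt_one_iff.1 (by exact_mod_cast h5)
    simp [h3, h6]
  -- The net change of θ is 0, so |θ y - θ x| is bounded both by the variation between x and y and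
  -- by the variation on the rest of the interval. These add up to less than 2π.
  have hosc : ∀ x ∈ Icc a b, ∀ y ∈ Icc a b, |θ y - θ x| < Real.pi := by
    have key : ∀ x ∈ Icc a b, ∀ y ∈ Icc a b, x ≤ y → |θ y - θ x| < Real.pi := by
      intro x hx y hy hxy
      have h1 := hvar x hx y hy hxy
      have h2 := hvar a ha x hx hx.1
      have h3 := hvar y hy b hb hy.2
      have h4 := intervalIntegral.integral_add_adjacent_intervals (hψs a ha x hx).abs
        (hψs x hx y hy).abs
      have h5 := intervalIntegral.integral_add_adjacent_intervals (hψs a ha y hy).abs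
        (hψs y hy b hb).abs
      rw [hθa] at h2
      rw [hθb] at h3
      have h6 : |θ y - θ x| ≤ |θ x - 0| + |0 - θ y| := by
        rw [abs_sub_comm, sub_zero, zero_sub, abs_neg]; exact abs_sub _ _
      linarith
    intro x hx y hy
    rcases le_total x y with hxy | hxy
    · exact key x hx y hy hxy
    · rw [abs_sub_comm]; exact key y hy x hx hxy
  obtain ⟨p, hp, hpm⟩ := isCompact_Icc.exists_isMinOn ⟨a, ha⟩ hθc
  obtain ⟨q, hq', hqm⟩ := isCompact_Icc.exists_isMaxOn ⟨a, ha⟩ hθc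
  set c := (θ p + θ q) / 2 with hc
  have hcos : ∀ x ∈ Icc a b, 0 < Real.cos (θ x - c) := by
    intro x hx
    have h1 : θ p ≤ θ x := hpm hx
    have h2 : θ x ≤ θ q := hqm hx
    have h3 := abs_lt.1 (hosc p hp q hq')
    exact Real.cos_pos_of_mem_Ioo ⟨by linarith, by linarith⟩
  -- Multiplication by m removes the factor v a and rotates the midpoint c of the range of θ to
  -- angle 0, so all directions fall within π/2 of the positive real axis.
  set m : ℂ := (v a)⁻¹ * Complex.exp (-(c * Complex.I)) with hm
  have hre : ∀ x ∈ Icc a b, 0 < (v x * m).re := by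
    intro x hx
    have h1 : v x * m = Complex.exp (G x - c * Complex.I) := by
      rw [hexp x hx, hm, sub_eq_add_neg, Complex.exp_add]
      have := hv0 a ha
      field_simp
      rfl
    rw [h1, Complex.exp_re]
    refine mul_pos (Real.exp_pos _) ?_
    have h2 : (G x - c * Complex.I).im = θ x - c := by simp [hθ]
    rw [h2]
    exact hcos x hx
  have hmc : ContinuousOn (fun x => v x * m) (Icc a b) := hvc.mul continuousOn_const
  have hpos : 0 < ∫ x in a..b, (v x * m).re :=
    intervalIntegral.intervalIntegral_pos_of_pos_on
      ((Complex.continuous_re.comp_continuousOn hmc).intervalIntegrable_of_Icc hab.le)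
      (fun x hx => hre x (Ioo_subset_Icc_self hx)) hab
  have hzero : ∫ x in a..b, (v x * m).re = 0 := by
    have := Complex.reCLM.intervalIntegral_comp_comm
      (hmc.intervalIntegrable_of_Icc (μ := volume) hab.le)
    simp only [Complex.reCLM_apply, intervalIntegral.integral_mul_const, hclosed, zero_mul,
      Complex.zero_re] at this
    exact this
  exact hpos.ne' hzero

/-! ### Weak derivatives and the lemma of du Bois-Reymond -/

/-- A smooth function with vanishing integral and compact support in `(a, b)` is the derivative of
a smooth function with compact support in `(a, b)`. -/
theorem exists_contDiff_tsupport_subset_deriv_eq {a b : ℝ} {χ : ℝ → ℝ}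
    (hχ : ContDiff ℝ ∞ χ) (hc : HasCompactSupport χ) (hs : tsupport χ ⊆ Ioo a b)
    (hint : ∫ x in a..b, χ x = 0) :
    ∃ φ : ℝ → ℝ, ContDiff ℝ ∞ φ ∧ HasCompactSupport φ ∧ tsupport φ ⊆ Ioo a b ∧ deriv φ = χ := by
  rcases (tsupport χ).eq_empty_or_nonempty with he | hne
  · refine ⟨0, contDiff_const, HasCompactSupport.zero, by simp [tsupport], ?_⟩
    rw [tsupport_eq_empty_iff] at he
    rw [he]
    exact deriv_const' (0 : ℝ)
  obtain ⟨c, hcm, hcl⟩ := hc.exists_isLeast hne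
  obtain ⟨d, hdm, hdg⟩ := hc.exists_isGreatest hne
  have hout : ∀ x, x ∉ Icc c d → χ x = 0 := fun x hx => by
    by_contra h
    exact hx ⟨hcl (subset_tsupport _ h), hdg (subset_tsupport _ h)⟩
  have hi : ∀ x y, IntervalIntegrable χ volume x y := fun x y =>
    hχ.continuous.intervalIntegrable x y
  have hder : ∀ x, HasDerivAt (fun x => ∫ t in a..x, χ t) (χ x) x := fun x =>
    intervalIntegral.integral_hasDerivAt_right (hi a x)
      (hχ.continuous.stronglyMeasurableAtFilter _ _) hχ.continuous.continuousAt
  have hd : deriv (fun x => ∫ t in a..x, χ t) = χ := funext fun x => (hder x).deriv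
  -- Left of c the primitive vanishes because χ does; right of d because the whole integral of χ is
  -- zero.
  have hsupp : Function.support (fun x => ∫ t in a..x, χ t) ⊆ Icc c d := by
    intro x hx
    by_contra hxcd
    refine hx ?_
    rw [mem_Icc, not_and_or, not_le, not_le] at hxcd
    rcases hxcd with hxc | hxd
    · refine intervalIntegral.integral_zero_ae (Filter.Eventually.of_forall fun t ht => hout t ?_)
      have h1 : t ≤ max a x := ht.2
      have h2 := (hs hcm).1
      intro h3
      have : max a x < c := max_lt h2 hxc
      linarith [h3.1]
    · have h1 : ∫ t in x..b, χ t = 0 := by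
        refine intervalIntegral.integral_zero_ae (Filter.Eventually.of_forall fun t ht => hout t ?_)
        have h1 : min x b < t := ht.1
        have h2 := (hs hdm).2
        intro h3
        have : d < min x b := lt_min hxd h2
        linarith [h3.2]
      have h2 := intervalIntegral.integral_add_adjacent_intervals (hi a x) (hi x b)
      rw [h1, hint, add_zero] at h2
      exact h2
  have htsupp : tsupport (fun x => ∫ t in a..x, χ t) ⊆ Icc c d :=
    closure_minimal hsupp isClosed_Icc
  refine ⟨fun x => ∫ t in a..x, χ t, ?_, ?_, ?_, hd⟩
  · rw [contDiff_infty_iff_deriv, hd]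
    exact ⟨fun x => (hder x).differentiableAt, hχ⟩
  · exact isCompact_Icc.of_isClosed_subset (isClosed_tsupport _) htsupp
  · exact htsupp.trans fun x hx => ⟨(hs hcm).1.trans_le hx.1, hx.2.trans_lt (hs hdm).2⟩

/-- The lemma of du Bois-Reymond: a continuous function with vanishing weak derivative is
constant. -/
theorem ContinuousOn.exists_const_of_integral_deriv_mul_eq_zero {a b : ℝ} (hab : a < b) {g : ℝ → ℝ}
    (hg : ContinuousOn g (Icc a b))
    (h : ∀ φ : ℝ → ℝ, ContDiff ℝ ∞ φ → HasCompactSupport φ → tsupport φ ⊆ Ioo a b →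
      ∫ x in a..b, deriv φ x * g x = 0) :
    ∃ C, ∀ x ∈ Icc a b, g x = C := by
  obtain ⟨ψ, hψs, hψc, hψ, hψr, hψ1⟩ := exists_contDiff_tsupport_subset (n := ⊤)
    (Ioo_mem_nhds (show a < (a + b) / 2 by linarith) (show (a + b) / 2 < b by linarith))
  have hsub : ∀ f : ℝ → ℝ, tsupport f ⊆ Ioo a b → ∫ x in a..b, f x = ∫ x, f x := fun f hf =>
    intervalIntegral.integral_eq_integral_of_support_subset
      ((subset_tsupport _).trans (hf.trans Ioo_subset_Ioc_self))
  have hψpos : 0 < ∫ x in a..b, ψ x := by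
    rw [hsub ψ hψs]
    exact hψ.continuous.integral_pos_of_hasCompactSupport_nonneg_nonzero hψc
      (fun x => (hψr (mem_range_self x)).1) (by rw [hψ1]; exact one_ne_zero)
  set S := ∫ x in a..b, ψ x with hS
  set C := (∫ x in a..b, ψ x * g x) / S with hC
  refine ⟨C, ?_⟩
  have hgi : ∀ f : ℝ → ℝ, ContDiff ℝ ∞ f → IntervalIntegrable (fun x => f x * g x) volume a b :=
    fun f hf => (hf.continuous.continuousOn.mul hg).intervalIntegrable_of_Icc hab.le
  -- Subtracting m ψ from f leaves integral zero, hence a derivative φ' of a test function. The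
  -- hypothesis then gives ∫ f g = m ∫ ψ g = C ∫ f.
  have key : ∀ f : ℝ → ℝ, ContDiff ℝ ∞ f → HasCompactSupport f → tsupport f ⊆ Ioo a b →
      ∫ x, f x • (g x - C) = 0 := by
    intro f hf hfc hfs
    set m := (∫ x in a..b, f x) / S with hm
    have hfi := hf.continuous.intervalIntegrable (μ := volume) a b
    have hψi := hψ.continuous.intervalIntegrable (μ := volume) a b
    have hts : tsupport (fun x => f x - m * ψ x) ⊆ tsupport f ∪ tsupport ψ := by
      refine closure_minimal (fun x hx => ?_) ((isClosed_tsupport _).union (isClosed_tsupport _))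
      by_contra h0
      rw [mem_union, not_or] at h0
      exact hx (by simp [image_eq_zero_of_notMem_tsupport h0.1,
        image_eq_zero_of_notMem_tsupport h0.2])
    obtain ⟨φ, h1, h2, h3, h4⟩ := exists_contDiff_tsupport_subset_deriv_eq
      (χ := fun x => f x - m * ψ x) (hf.sub (contDiff_const.mul hψ))
      ((hfc.union hψc).of_isClosed_subset (isClosed_tsupport _) hts)
      (hts.trans (union_subset hfs hψs)) (by
        rw [intervalIntegral.integral_sub hfi (hψi.const_mul m),
          intervalIntegral.integral_const_mul, ← hS, hm, div_mul_cancel₀ _ hψpos.ne', sub_self])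
    have h5 := h φ h1 h2 h3
    rw [h4] at h5
    have h6 : ∫ x in a..b, (f x - m * ψ x) * g x =
        (∫ x in a..b, f x * g x) - m * ∫ x in a..b, ψ x * g x := by
      rw [← intervalIntegral.integral_const_mul, ← intervalIntegral.integral_sub (hgi f hf)
        ((hgi ψ hψ).const_mul m)]
      exact intervalIntegral.integral_congr fun x _ => by ring
    rw [← hsub (fun x => f x • (g x - C)) ((closure_mono fun x hx =>
      left_ne_zero_of_mul hx).trans hfs)]
    have h7 : ∫ x in a..b, f x • (g x - C) =
        (∫ x in a..b, f x * g x) - C * ∫ x in a..b, f x := by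
      rw [← intervalIntegral.integral_const_mul, ← intervalIntegral.integral_sub (hgi f hf)
        (hfi.const_mul C)]
      exact intervalIntegral.integral_congr fun x _ => by simp only [smul_eq_mul]; ring
    rw [h7, ← h5, h6, hC, hm]
    ring
  have hloc : LocallyIntegrableOn (fun x => g x - C) (Ioo a b) :=
    ((hg.sub continuousOn_const).integrableOn_Icc.mono_set
      Ioo_subset_Icc_self).locallyIntegrableOn
  have hae := isOpen_Ioo.ae_eq_zero_of_integral_contDiff_smul_eq_zero hloc key
  have hae' : g =ᵐ[volume.restrict (Icc a b)] fun _ => C := by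
    rw [← restrict_Ioo_eq_restrict_Icc]
    refine (ae_restrict_iff' measurableSet_Ioo).2 ?_
    filter_upwards [hae] with x hx hxI
    linarith [hx hxI]
  exact Measure.eqOn_Icc_of_ae_eq volume hab.ne hae' hg continuousOn_const

/-- A continuous function with integrable weak derivative `h` is a primitive of `h`. -/
theorem ContinuousOn.eq_add_integral_of_weakDeriv {a b : ℝ} (hab : a < b) {u h : ℝ → ℝ}
    (hu : ContinuousOn u (Icc a b)) (hh : IntervalIntegrable h volume a b)
    (hw : ∀ φ : ℝ → ℝ, ContDiff ℝ ∞ φ → HasCompactSupport φ → tsupport φ ⊆ Ioo a b →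
      ∫ x in a..b, deriv φ x * u x = -∫ x in a..b, φ x * h x) :
    ∀ x ∈ Icc a b, u x = u a + ∫ t in a..x, h t := by
  have hH := hh.absolutelyContinuousOnInterval_intervalIntegral (c := a) (by simp)
  have hHc : ContinuousOn (fun x => ∫ t in a..x, h t) (Icc a b) := by
    rw [← uIcc_of_le hab.le]; exact hH.continuousOn
  -- Integration by parts against the absolutely continuous primitive of h shows that u minus this
  -- primitive has zero weak derivative.
  obtain ⟨C, hC⟩ := (hu.sub hHc).exists_const_of_integral_deriv_mul_eq_zero hab (by
    intro φ h1 h2 h3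
    have hφ : AbsolutelyContinuousOnInterval φ a b :=
      (h1.of_le (by simp)).contDiffOn.absolutelyContinuousOnInterval
    have hzero : ∀ x, x ∉ Ioo a b → φ x = 0 := fun x hx =>
      image_eq_zero_of_notMem_tsupport fun h => hx (h3 h)
    have hparts := hφ.integral_mul_deriv_eq_deriv_mul hH
    rw [hzero a (by simp), hzero b (by simp), zero_mul, zero_mul, sub_zero, zero_sub] at hparts
    have hd : ∫ x in a..b, φ x * deriv (fun x => ∫ t in a..x, h t) x = ∫ x in a..b, φ x * h x := by
      refine intervalIntegral.integral_congr_ae ?_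
      filter_upwards [hh.ae_hasDerivAt_integral] with x hx hxI
      rw [(hx (uIoc_subset_uIcc hxI) a (by simp)).deriv]
    have hdc : ContinuousOn (deriv φ) (Icc a b) := (h1.continuous_deriv (by simp)).continuousOn
    have hsplit : ∫ x in a..b, deriv φ x * (u x - ∫ t in a..x, h t) =
        (∫ x in a..b, deriv φ x * u x) - ∫ x in a..b, deriv φ x * ∫ t in a..x, h t := by
      rw [← intervalIntegral.integral_sub
        (f := fun x => deriv φ x * u x) (g := fun x => deriv φ x * ∫ t in a..x, h t)
        ((hdc.mul hu).intervalIntegrable_of_Icc hab.le)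
        ((hdc.mul hHc).intervalIntegrable_of_Icc hab.le)]
      exact intervalIntegral.integral_congr fun x _ => mul_sub _ _ _
    refine hsplit.trans ?_
    rw [hw φ h1 h2 h3, ← hd, hparts]
    ring)
  intro x hx
  have e1 := hC x hx
  have e2 := hC a ⟨le_rfl, hab.le⟩
  simp only [Pi.sub_apply, intervalIntegral.integral_same] at e1 e2
  linarith

/-! ### H¹ functions as primitives -/

namespace LM

theorem uniqueDiffOn_I : UniqueDiffOn ℝ I := uniqueDiffOn_Icc Real.two_pi_pos

theorem isFiniteMeasure_restrict_I : IsFiniteMeasure (volume.restrict I) :=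
  ⟨by rw [Measure.restrict_apply_univ]; exact measure_Icc_lt_top⟩

theorem inner_plane (v w : Plane) : inner ℝ v w = v 0 * w 0 + v 1 * w 1 := by
  simp [PiLp.inner_apply, Fin.sum_univ_two, mul_comm]

theorem norm_sq_plane (v : Plane) : ‖v‖ ^ 2 = v 0 ^ 2 + v 1 ^ 2 := by
  simp [EuclideanSpace.norm_sq_eq, Fin.sum_univ_two]

theorem intervalIntegral_plane_apply {f : ℝ → Plane} {a b : ℝ}
    (hf : IntervalIntegrable f volume a b) (i : Fin 2) :
    (∫ x in a..b, f x) i = ∫ x in a..b, f x i :=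
  ((EuclideanSpace.proj i : Plane →L[ℝ] ℝ).intervalIntegral_comp_comm hf).symm

theorem intervalIntegrable_of_memLp_two {E : Type*} [NormedAddCommGroup E] {f : ℝ → E}
    (hf : MemLp f 2 (volume.restrict I)) : IntervalIntegrable f volume 0 (2 * Real.pi) := by
  rw [intervalIntegrable_iff_integrableOn_Icc_of_le Real.two_pi_pos.le]
  have := isFiniteMeasure_restrict_I
  exact hf.integrable (by norm_num)

theorem MemH1.intervalIntegrable_dx {f : ℝ → Plane} (hf : MemH1 f) :
    IntervalIntegrable (dx f) volume 0 (2 * Real.pi) :=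
  intervalIntegrable_of_memLp_two hf.2.1

theorem MemH1.memLp_dx_apply {f : ℝ → Plane} (hf : MemH1 f) (i : Fin 2) :
    MemLp (fun x => dx f x i) 2 (volume.restrict I) :=
  (EuclideanSpace.proj i : Plane →L[ℝ] ℝ).comp_memLp' hf.2.1

theorem MemH1.intervalIntegrable_dx_apply {f : ℝ → Plane} (hf : MemH1 f) (i : Fin 2) :
    IntervalIntegrable (fun x => dx f x i) volume 0 (2 * Real.pi) :=
  intervalIntegrable_of_memLp_two (hf.memLp_dx_apply i)

theorem MemH1.continuousOn_apply {f : ℝ → Plane} (hf : MemH1 f) (i : Fin 2) :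
    ContinuousOn (fun x => f x i) I :=
  (EuclideanSpace.proj i : Plane →L[ℝ] ℝ).continuous.comp_continuousOn hf.1

/-- The fundamental theorem of calculus for `H¹` functions. -/
theorem MemH1.apply_eq_add_integral {f : ℝ → Plane} (hf : MemH1 f) (i : Fin 2) :
    ∀ x ∈ I, f x i = f 0 i + ∫ t in 0..x, dx f t i := by
  refine (hf.continuousOn_apply i).eq_add_integral_of_weakDeriv Real.two_pi_pos
    (hf.intervalIntegrable_dx_apply i) fun φ h1 h2 h3 => ?_
  have h := congrArg (fun v : Plane => v i) (hf.2.2 φ h1 h2 h3)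
  have i1 : IntervalIntegrable (fun x => deriv φ x • f x) volume 0 (2 * Real.pi) :=
    (((h1.continuous_deriv (by simp)).continuousOn).smul hf.1).intervalIntegrable_of_Icc
      Real.two_pi_pos.le
  have i2 : IntervalIntegrable (fun x => φ x • dx f x) volume 0 (2 * Real.pi) :=
    hf.intervalIntegrable_dx.continuousOn_smul h1.continuous.continuousOn
  simpa only [PiLp.neg_apply, intervalIntegral_plane_apply i1, intervalIntegral_plane_apply i2,
    PiLp.smul_apply, smul_eq_mul] using h

/-- Each component is a primitive, so Lebesgue differentiation applies. This is needed because `dx`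
takes a default value where the derivative fails to exist. -/
theorem MemH1.ae_differentiableWithinAt {f : ℝ → Plane} (hf : MemH1 f) :
    ∀ᵐ x, x ∈ I → DifferentiableWithinAt ℝ f I x := by
  have key : ∀ i, ∀ᵐ x, x ∈ I → DifferentiableWithinAt ℝ (fun x => f x i) I x := by
    intro i
    filter_upwards [(hf.intervalIntegrable_dx_apply i).ae_hasDerivAt_integral] with x hx hxI
    rw [uIcc_of_le Real.two_pi_pos.le] at hx
    have h1 := (hx hxI 0 ⟨le_rfl, Real.two_pi_pos.le⟩).const_add (f 0 i)
    exact (h1.hasDerivWithinAt.congr (hf.apply_eq_add_integral i)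
      (hf.apply_eq_add_integral i x hxI)).differentiableWithinAt
  filter_upwards [key 0, key 1] with x h0 h1 hx
  rw [differentiableWithinAt_euclidean]
  intro i
  fin_cases i
  · exact h0 hx
  · exact h1 hx

/-! ### Curvature in coordinates and Fenchel's inequality in H² -/

theorem norm_tangent {γ : ℝ → Plane} {x : ℝ} (hx : dx γ x ≠ 0) : ‖tangent γ x‖ = 1 := by
  rw [tangent, ds, norm_smul, norm_inv, norm_norm, inv_mul_cancel₀ (norm_ne_zero_iff.2 hx)]

/-- `κ = ⟨∂ₓ²γ, J ∂ₓγ⟩ / |∂ₓγ|³` wherever `∂ₓγ` is differentiable. -/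
theorem curvature_eq {γ : ℝ → Plane} {x : ℝ} (hx : x ∈ I)
    (hd : DifferentiableWithinAt ℝ (dx γ) I x) (h0 : dx γ x ≠ 0) :
    curvature γ x =
      (dx (dx γ) x 1 * dx γ x 0 - dx (dx γ) x 0 * dx γ x 1) * (‖dx γ x‖⁻¹) ^ 3 := by
  have h1 : DifferentiableWithinAt ℝ (fun y => ‖dx γ y‖⁻¹) I x :=
    (hd.norm ℝ h0).inv (norm_ne_zero_iff.2 h0)
  have h2 := h1.hasDerivWithinAt.smul hd.hasDerivWithinAt
  -- The second summand is parallel to ∂ₓγ, hence orthogonal to ν, and drops out of the curvature.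
  have h3 : dx (tangent γ) x = ‖dx γ x‖⁻¹ • dx (dx γ) x +
      derivWithin (fun y => ‖dx γ y‖⁻¹) I x • dx γ x :=
    h2.derivWithin (uniqueDiffOn_I x hx)
  rw [curvature, ds, h3, inner_plane, normal, tangent, ds, rotJ]
  simp
  ring

/-- **Fenchel's inequality** for curves in `H²_imm`. -/
theorem two_pi_le_lineIntegral_abs_curvature {γ : ℝ → Plane} (hγ : MemH2imm γ) :
    2 * Real.pi ≤ lineIntegral γ (fun x => |curvature γ x|) := by
  obtain ⟨⟨h1, h2⟩, hne, hper, hper'⟩ := hγ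
  have hI0 : (0 : ℝ) ∈ I := ⟨le_rfl, Real.two_pi_pos.le⟩
  have hI1 : 2 * Real.pi ∈ I := ⟨Real.two_pi_pos.le, le_rfl⟩
  set v : ℝ → ℂ := fun x => ⟨dx γ x 0, dx γ x 1⟩ with hv
  set h : ℝ → ℂ := fun x => ⟨dx (dx γ) x 0, dx (dx γ) x 1⟩ with hh
  have hcomplex : ∀ p q : ℝ → ℝ, ∀ a b, IntervalIntegrable p volume a b →
      IntervalIntegrable q volume a b →
      IntervalIntegrable (fun x => (⟨p x, q x⟩ : ℂ)) volume a b ∧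
        ∫ x in a..b, (⟨p x, q x⟩ : ℂ) = ⟨∫ x in a..b, p x, ∫ x in a..b, q x⟩ := by
    intro p q a b hp hq
    have e : (fun x => (⟨p x, q x⟩ : ℂ)) = fun x => (p x : ℂ) + q x * Complex.I :=
      funext fun x => Complex.mk_eq_add_mul_I _ _
    have hp' : IntervalIntegrable (fun x => (p x : ℂ)) volume a b := ⟨hp.1.ofReal, hp.2.ofReal⟩
    have hq' : IntervalIntegrable (fun x => (q x : ℂ)) volume a b := ⟨hq.1.ofReal, hq.2.ofReal⟩
    rw [e]
    refine ⟨hp'.add (hq'.mul_const _), ?_⟩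
    rw [intervalIntegral.integral_add hp' (hq'.mul_const _), intervalIntegral.integral_mul_const,
      intervalIntegral.integral_ofReal, intervalIntegral.integral_ofReal, Complex.mk_eq_add_mul_I]
  have hhi : ∀ i, IntervalIntegrable (fun x => dx (dx γ) x i) volume 0 (2 * Real.pi) :=
    h2.intervalIntegrable_dx_apply
  have hvi : ∀ i, IntervalIntegrable (fun x => dx γ x i) volume 0 (2 * Real.pi) :=
    h1.intervalIntegrable_dx_apply
  have hv0 : ∀ x ∈ Icc 0 (2 * Real.pi), v x ≠ 0 := by
    intro x hx h0
    refine hne x hx ?_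
    ext i
    fin_cases i
    · exact congrArg Complex.re h0
    · exact congrArg Complex.im h0
  have hvc : ContinuousOn v (Icc 0 (2 * Real.pi)) := by
    have e : v = fun x => (dx γ x 0 : ℂ) + dx γ x 1 * Complex.I :=
      funext fun x => Complex.mk_eq_add_mul_I _ _
    rw [e]
    exact (Complex.continuous_ofReal.comp_continuousOn (h2.continuousOn_apply 0)).add
      ((Complex.continuous_ofReal.comp_continuousOn (h2.continuousOn_apply 1)).mul
        continuousOn_const)
  have hvh : ∀ x ∈ Icc 0 (2 * Real.pi), v x = v 0 + ∫ t in 0..x, h t := by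
    intro x hx
    have hs : uIcc 0 x ⊆ uIcc 0 (2 * Real.pi) := by
      rw [uIcc_of_le Real.two_pi_pos.le]; exact uIcc_subset_Icc hI0 hx
    rw [(hcomplex _ _ 0 x ((hhi 0).mono_set hs) ((hhi 1).mono_set hs)).2]
    apply Complex.ext
    · exact h2.apply_eq_add_integral 0 x hx
    · exact h2.apply_eq_add_integral 1 x hx
  have hclosed : ∫ x in 0..(2 * Real.pi), v x = 0 := by
    rw [(hcomplex _ _ 0 (2 * Real.pi) (hvi 0) (hvi 1)).2]
    have e : ∀ i, ∫ x in 0..(2 * Real.pi), dx γ x i = 0 := by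
      intro i
      have := h1.apply_eq_add_integral i _ hI1
      rw [← hper] at this
      linarith
    rw [e 0, e 1]
    rfl
  refine (two_pi_le_integral_abs_im_logDeriv Real.two_pi_pos (hcomplex _ _ _ _ (hhi 0) (hhi 1)).1
    hvh hvc hv0 (by simp only [hv, hper']) hclosed).trans_eq ?_
  -- Im(h/v) = κ |∂ₓγ| at every point where ∂ₓγ is differentiable.
  refine intervalIntegral.integral_congr_ae ?_
  filter_upwards [h2.ae_differentiableWithinAt] with x hx hxI
  have hxI' : x ∈ I := by
    rw [uIoc_of_le Real.two_pi_pos.le] at hxI; exact Ioc_subset_Icc_self hxI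
  have hw : ‖dx γ x‖ ≠ 0 := norm_ne_zero_iff.2 (hne x hxI')
  have hns : Complex.normSq (v x) = ‖dx γ x‖ ^ 2 := by
    rw [norm_sq_plane, Complex.normSq_apply, sq, sq]
  rw [curvature_eq hxI' (hx hxI') (hne x hxI'), Complex.div_im, hns,
    ← abs_of_nonneg (norm_nonneg (dx γ x)), ← abs_mul, abs_of_nonneg (norm_nonneg (dx γ x))]
  congr 1
  simp only [hv]
  field_simp

/-! ### The lower bound for the energy -/

theorem matNormSq_gradCurve (γ η : ℝ → Plane) (x : ℝ) :
    matNormSq (gradCurve γ η x) = ‖ds γ η x‖ ^ 2 * ‖tangent γ x‖ ^ 2 := by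
  simp only [matNormSq, gradCurve, Matrix.of_apply, Fin.sum_univ_two, norm_sq_plane]
  ring

theorem sq_divCurve_le (γ η : ℝ → Plane) (x : ℝ) :
    divCurve γ η x ^ 2 ≤ matNormSq (gradCurve γ η x) := by
  rw [matNormSq_gradCurve, ← mul_pow]
  exact sq_le_sq' (neg_le_of_abs_le (abs_real_inner_le_norm _ _)) (real_inner_le_norm _ _)

/-- Multiplied by λ + δ², the quadratic ½(κ + δd)² + (λ/2)d² equals (λ/2)κ² plus half the square of
δκ + (λ + δ²)d. The term +1 is the density of the length and is absorbed by (R|κ| - 1)² ≥ 0. -/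
theorem two_mul_radius_mul_abs_le {δ lam R κ d N : ℝ} (hlam : 0 < lam)
    (hR2 : 2 * R ^ 2 * (lam + δ ^ 2) = lam) (hN : d ^ 2 ≤ N) :
    2 * R * |κ| ≤ 1 / 2 * (κ + δ * d) ^ 2 + lam / 2 * N + 1 := by
  have hpos : 0 < lam + δ ^ 2 := by positivity
  have h1 : R ^ 2 * κ ^ 2 ≤ 1 / 2 * (κ + δ * d) ^ 2 + lam / 2 * d ^ 2 := by
    refine le_of_mul_le_mul_left ?_ hpos
    have e : (lam + δ ^ 2) * (R ^ 2 * κ ^ 2) = lam / 2 * κ ^ 2 := by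
      linear_combination κ ^ 2 / 2 * hR2
    rw [e]
    linarith [sq_nonneg (δ * κ + (lam + δ ^ 2) * d)]
  have h2 : lam / 2 * d ^ 2 ≤ lam / 2 * N := by gcongr
  have h3 : 2 * R * |κ| ≤ R ^ 2 * κ ^ 2 + 1 := by
    rw [← sq_abs κ]; linarith [sq_nonneg (R * |κ| - 1)]
  linarith

/-- Curvature and divergence are built from L² derivatives and continuous factors. Their square
integrability keeps the integrals in the energy from taking the default value 0. -/
theorem memLp_mul_continuousOn {f g : ℝ → ℝ} (hf : MemLp f 2 (volume.restrict I))
    (hg : ContinuousOn g I) : MemLp (fun x => f x * g x) 2 (volume.restrict I) := by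
  obtain ⟨C, hC⟩ := isCompact_Icc.exists_bound_of_continuousOn hg
  have hg' : MemLp g ⊤ (volume.restrict I) :=
    memLp_top_of_bound (hg.aestronglyMeasurable measurableSet_Icc) C
      ((ae_restrict_iff' measurableSet_Icc).2 (Filter.Eventually.of_forall hC))
  exact hg'.mul' hf

theorem intervalIntegrable_sq_mul {f g : ℝ → ℝ} (hf : MemLp f 2 (volume.restrict I))
    (hg : ContinuousOn g I) :
    IntervalIntegrable (fun x => f x ^ 2 * g x) volume 0 (2 * Real.pi) := by
  have h1 : IntervalIntegrable (fun x => f x ^ 2) volume 0 (2 * Real.pi) := by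
    rw [intervalIntegrable_iff_integrableOn_Icc_of_le Real.two_pi_pos.le]
    exact hf.integrable_sq
  exact h1.mul_continuousOn (by rwa [uIcc_of_le Real.two_pi_pos.le])

/-- Every admissible pair has energy at least `4πR`, where `2 R² (λ + δ²) = λ`. -/
theorem four_pi_radius_le_energy {δ lam R : ℝ} (hlam : 0 < lam) (hR : 0 < R)
    (hR2 : 2 * R ^ 2 * (lam + δ ^ 2) = lam) {γ η : ℝ → Plane} (hγ : MemH2imm γ) (hη : MemH1 η) :
    4 * Real.pi * R ≤ energy δ lam γ η := by
  have hF := two_pi_le_lineIntegral_abs_curvature hγ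
  obtain ⟨⟨h1, h2⟩, hne, -, -⟩ := hγ
  have hw : ContinuousOn (fun x => ‖dx γ x‖) I := h2.1.norm
  have hw' : ContinuousOn (fun x => ‖dx γ x‖⁻¹) I :=
    hw.inv₀ fun x hx => norm_ne_zero_iff.2 (hne x hx)
  have hvc := h2.continuousOn_apply
  have hwi : IntervalIntegrable (fun x => ‖dx γ x‖) volume 0 (2 * Real.pi) :=
    hw.intervalIntegrable_of_Icc Real.two_pi_pos.le
  have hκ : MemLp (curvature γ) 2 (volume.restrict I) := by
    refine MemLp.ae_eq ?_ (memLp_mul_continuousOn (MemLp.sub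
      (memLp_mul_continuousOn (h2.memLp_dx_apply 1) (hvc 0))
      (memLp_mul_continuousOn (h2.memLp_dx_apply 0) (hvc 1))) (hw'.pow 3))
    refine (ae_restrict_iff' measurableSet_Icc).2 ?_
    filter_upwards [h2.ae_differentiableWithinAt] with x hx hxI
    exact (curvature_eq hxI (hx hxI) (hne x hxI)).symm
  have hdiv : MemLp (divCurve γ η) 2 (volume.restrict I) := by
    have e : divCurve γ η = fun x =>
        (dx η x 0 * dx γ x 0 + dx η x 1 * dx γ x 1) * (‖dx γ x‖⁻¹) ^ 2 := by
      funext x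
      rw [divCurve, inner_plane, tangent, ds, ds]
      simp only [PiLp.smul_apply, smul_eq_mul]
      ring
    rw [e]
    exact memLp_mul_continuousOn (MemLp.add
      (memLp_mul_continuousOn (hη.memLp_dx_apply 0) (hvc 0))
      (memLp_mul_continuousOn (hη.memLp_dx_apply 1) (hvc 1))) (hw'.pow 2)
  have hi1 : IntervalIntegrable
      (fun x => (curvature γ x + δ * divCurve γ η x) ^ 2 * ‖dx γ x‖) volume 0 (2 * Real.pi) :=
    intervalIntegrable_sq_mul (hκ.add (hdiv.const_mul δ)) hw
  have hi2 : IntervalIntegrable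
      (fun x => matNormSq (gradCurve γ η x) * ‖dx γ x‖) volume 0 (2 * Real.pi) := by
    -- The factor |τ|² is not replaced by 1, so the identity holds for every real x, even where ∂ₓγ
    -- vanishes.
    have e : (fun x => matNormSq (gradCurve γ η x) * ‖dx γ x‖) = fun x =>
        ‖dx η x‖ ^ 2 * (‖dx γ x‖⁻¹ ^ 2 * (‖dx γ x‖⁻¹ ^ 2 * ‖dx γ x‖ ^ 2) * ‖dx γ x‖) := by
      funext x
      rw [matNormSq_gradCurve, tangent, ds, ds, norm_smul, norm_smul, norm_inv, norm_norm]
      ring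
    rw [e]
    exact intervalIntegrable_sq_mul hη.2.1.norm
      (((hw'.pow 2).mul ((hw'.pow 2).mul (hw.pow 2))).mul hw)
  have hi3 : IntervalIntegrable (fun x => |curvature γ x| * ‖dx γ x‖) volume 0 (2 * Real.pi) :=
    intervalIntegrable_of_memLp_two (memLp_mul_continuousOn hκ.norm hw)
  have hsum : energy δ lam γ η = ∫ x in 0..(2 * Real.pi),
      (1 / 2 * ((curvature γ x + δ * divCurve γ η x) ^ 2 * ‖dx γ x‖) +
        lam / 2 * (matNormSq (gradCurve γ η x) * ‖dx γ x‖) + ‖dx γ x‖) := by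
    rw [intervalIntegral.integral_add ((hi1.const_mul _).add (hi2.const_mul _)) hwi,
      intervalIntegral.integral_add (hi1.const_mul _) (hi2.const_mul _),
      intervalIntegral.integral_const_mul, intervalIntegral.integral_const_mul]
    rfl
  calc 4 * Real.pi * R = 2 * R * (2 * Real.pi) := by ring
    _ ≤ 2 * R * lineIntegral γ (fun x => |curvature γ x|) := by gcongr
    _ = ∫ x in 0..(2 * Real.pi), 2 * R * (|curvature γ x| * ‖dx γ x‖) := by
      rw [intervalIntegral.integral_const_mul]; rfl
    _ ≤ energy δ lam γ η := by
      rw [hsum]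
      refine intervalIntegral.integral_mono_on Real.two_pi_pos.le (hi3.const_mul _)
        (((hi1.const_mul _).add (hi2.const_mul _)).add hwi) fun x _ => ?_
      have := mul_le_mul_of_nonneg_right (two_mul_radius_mul_abs_le (κ := curvature γ x) hlam hR2
        (sq_divCurve_le γ η x)) (norm_nonneg (dx γ x))
      linarith

/-! ### Circles and their energy -/

/-- A function that agrees on `I` with a `C¹` function is in `H¹`. -/
theorem memH1_of_eqOn {f f' g : ℝ → Plane} (hf : ∀ x, HasDerivAt f (f' x) x)
    (hf' : Continuous f') (hg : EqOn g f I) : MemH1 g ∧ EqOn (dx g) f' I := by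
  have hdx : EqOn (dx g) f' I := fun x hx => by
    rw [dx, derivWithin_congr hg (hg hx)]
    exact (hf x).hasDerivWithinAt.derivWithin (uniqueDiffOn_I x hx)
  have hfc : Continuous f := continuous_iff_continuousAt.2 fun x => (hf x).continuousAt
  have hdc : ContinuousOn (dx g) I := hf'.continuousOn.congr hdx
  refine ⟨⟨hfc.continuousOn.congr hg, ?_, ?_⟩, hdx⟩
  · obtain ⟨C, hC⟩ := isCompact_Icc.exists_bound_of_continuousOn hdc
    have := isFiniteMeasure_restrict_I
    exact MemLp.of_bound (hdc.aestronglyMeasurable measurableSet_Icc) C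
      ((ae_restrict_iff' measurableSet_Icc).2 (Filter.Eventually.of_forall hC))
  · intro φ h1 h2 h3
    have hzero : ∀ x, x ∉ Ioo 0 (2 * Real.pi) → φ x = 0 := fun x hx =>
      image_eq_zero_of_notMem_tsupport fun h => hx (h3 h)
    have hφ : ∀ x, HasDerivAt φ (deriv φ x) x := fun x =>
      (h1.differentiable (by simp) x).hasDerivAt
    have hφ' : Continuous (deriv φ) := h1.continuous_deriv (by simp)
    have h4 := intervalIntegral.integral_smul_deriv_eq_deriv_smul_of_hasDerivAt
      (a := 0) (b := 2 * Real.pi) h1.continuous.continuousOn hfc.continuousOn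
      (fun x _ => hφ x) (fun x _ => hf x) (hφ'.intervalIntegrable _ _)
      (hf'.intervalIntegrable _ _)
    rw [hzero 0 (by simp), hzero (2 * Real.pi) (by simp), zero_smul, zero_smul, sub_zero,
      zero_sub] at h4
    have hIu : ∀ x ∈ uIcc 0 (2 * Real.pi), x ∈ I := fun x hx => by
      rwa [uIcc_of_le Real.two_pi_pos.le] at hx
    have e1 : ∫ x in 0..(2 * Real.pi), deriv φ x • g x = ∫ x in 0..(2 * Real.pi), deriv φ x • f x :=
      intervalIntegral.integral_congr fun x hx => by simp only [hg (hIu x hx)]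
    have e2 : ∫ x in 0..(2 * Real.pi), φ x • dx g x = ∫ x in 0..(2 * Real.pi), φ x • f' x :=
      intervalIntegral.integral_congr fun x hx => by simp only [hdx (hIu x hx)]
    rw [e1, e2, h4, neg_neg]

/-- The circle of radius `r`. -/
noncomputable def circleCurve (r : ℝ) : ℝ → Plane := fun x => !₂[r * Real.cos x, r * Real.sin x]

/-- The derivative of the circle of radius `r`. -/
noncomputable def circleVelocity (r : ℝ) : ℝ → Plane :=
  fun x => !₂[-(r * Real.sin x), r * Real.cos x]

theorem continuous_circleCurve (r : ℝ) : Continuous (circleCurve r) := by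
  unfold circleCurve; fun_prop

theorem continuous_circleVelocity (r : ℝ) : Continuous (circleVelocity r) := by
  unfold circleVelocity; fun_prop

theorem hasDerivAt_plane {f : ℝ → Plane} {f' : Plane} {x : ℝ}
    (h : ∀ i, HasDerivAt (fun y => f y i) (f' i) x) : HasDerivAt f f' x := by
  rw [← hasDerivWithinAt_univ, hasDerivWithinAt_iff_hasFDerivWithinAt, hasFDerivWithinAt_euclidean]
  intro i
  exact (h i).hasDerivWithinAt.hasFDerivWithinAt.congr_fderiv (by ext; simp)

theorem hasDerivAt_circleCurve (r x : ℝ) :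
    HasDerivAt (circleCurve r) (circleVelocity r x) x := by
  refine hasDerivAt_plane fun i => ?_
  fin_cases i
  · simpa [circleCurve, circleVelocity] using (Real.hasDerivAt_cos x).const_mul r
  · simpa [circleCurve, circleVelocity] using (Real.hasDerivAt_sin x).const_mul r

/-- The acceleration is minus the position, written as a circle of negative radius. -/
theorem hasDerivAt_circleVelocity (r x : ℝ) :
    HasDerivAt (circleVelocity r) (circleCurve (-r) x) x := by
  refine hasDerivAt_plane fun i => ?_
  fin_cases i
  · simpa [circleCurve, circleVelocity] using ((Real.hasDerivAt_sin x).const_mul r).fun_neg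
  · simpa [circleCurve, circleVelocity] using (Real.hasDerivAt_cos x).const_mul r

theorem norm_circleVelocity {r : ℝ} (hr : 0 ≤ r) (x : ℝ) : ‖circleVelocity r x‖ = r := by
  rw [← sq_eq_sq₀ (norm_nonneg _) hr, norm_sq_plane]
  simp only [circleVelocity, Matrix.cons_val_zero, Matrix.cons_val_one, PiLp.toLp_apply]
  linear_combination r ^ 2 * Real.sin_sq_add_cos_sq x

theorem integral_circleCurve (r : ℝ) : ∫ x in 0..(2 * Real.pi), circleCurve r x = 0 := by
  ext i
  rw [intervalIntegral_plane_apply ((continuous_circleCurve r).intervalIntegrable _ _)]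
  fin_cases i <;> simp [circleCurve]

theorem memH1_circleCurve (r : ℝ) :
    MemH1 (circleCurve r) ∧ EqOn (dx (circleCurve r)) (circleVelocity r) I :=
  memH1_of_eqOn (hasDerivAt_circleCurve r) (continuous_circleVelocity r) fun _ _ => rfl

theorem circleCurve_zero_eq (r : ℝ) : circleCurve r 0 = circleCurve r (2 * Real.pi) := by
  simp [circleCurve]

theorem memH1per_circleCurve (r : ℝ) : MemH1per (circleCurve r) :=
  ⟨(memH1_circleCurve r).1, circleCurve_zero_eq r⟩

theorem memH2imm_circleCurve {r : ℝ} (hr : 0 < r) : MemH2imm (circleCurve r) := by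
  have h := memH1_circleCurve r
  -- The derivative `dx` of the circle is known only on `I`, which is why `memH1_of_eqOn` asks for
  -- agreement on `I` alone.
  refine ⟨⟨h.1, (memH1_of_eqOn (hasDerivAt_circleVelocity r) (continuous_circleCurve (-r)) h.2).1⟩,
    fun x hx => ?_, circleCurve_zero_eq r, ?_⟩
  · rw [h.2 hx, ← norm_ne_zero_iff, norm_circleVelocity hr.le]
    exact hr.ne'
  · rw [h.2 ⟨le_rfl, Real.two_pi_pos.le⟩, h.2 ⟨Real.two_pi_pos.le, le_rfl⟩]
    simp [circleVelocity]

theorem curvature_circleCurve {r x : ℝ} (hr : 0 < r) (hx : x ∈ I) :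
    curvature (circleCurve r) x = r⁻¹ := by
  have h := (memH1_circleCurve r).2
  have h' := (memH1_of_eqOn (hasDerivAt_circleVelocity r) (continuous_circleCurve (-r)) h).2
  have hd : DifferentiableWithinAt ℝ (dx (circleCurve r)) I x :=
    (hasDerivAt_circleVelocity r x).differentiableAt.differentiableWithinAt.congr h (h hx)
  have hn : circleVelocity r x ≠ 0 := by
    rw [← norm_ne_zero_iff, norm_circleVelocity hr.le]; exact hr.ne'
  rw [curvature_eq hx hd (by rwa [h hx]), h' hx, h hx, norm_circleVelocity hr.le]
  simp only [circleVelocity, circleCurve, Matrix.cons_val_zero, Matrix.cons_val_one,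
    PiLp.toLp_apply]
  field_simp
  linear_combination Real.sin_sq_add_cos_sq x

theorem divCurve_circleCurve {r s x : ℝ} (hr : 0 < r) (hx : x ∈ I) :
    divCurve (circleCurve r) (circleCurve s) x = s / r := by
  rw [divCurve, tangent, ds, ds, (memH1_circleCurve r).2 hx, (memH1_circleCurve s).2 hx,
    norm_circleVelocity hr.le, inner_plane]
  simp only [circleVelocity, Matrix.cons_val_zero, Matrix.cons_val_one, PiLp.smul_apply,
    smul_eq_mul]
  field_simp
  linear_combination s * Real.sin_sq_add_cos_sq x

theorem matNormSq_gradCurve_circleCurve {r s x : ℝ} (hr : 0 < r) (hx : x ∈ I) :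
    matNormSq (gradCurve (circleCurve r) (circleCurve s) x) = (s / r) ^ 2 := by
  have h := (memH1_circleCurve r).2 hx
  rw [matNormSq_gradCurve, norm_tangent (by
    rw [h, ← norm_ne_zero_iff, norm_circleVelocity hr.le]; exact hr.ne'), ds, h,
    (memH1_circleCurve s).2 hx, norm_circleVelocity hr.le, norm_smul, mul_pow, norm_sq_plane]
  simp only [circleVelocity, Matrix.cons_val_zero, Matrix.cons_val_one, PiLp.toLp_apply,
    Real.norm_eq_abs, sq_abs]
  field_simp
  linear_combination s ^ 2 * Real.sin_sq_add_cos_sq x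

theorem curveLength_circleCurve {r : ℝ} (hr : 0 < r) :
    curveLength (circleCurve r) = 2 * Real.pi * r := by
  have e : ∫ x in 0..(2 * Real.pi), ‖dx (circleCurve r) x‖ = ∫ _ in 0..(2 * Real.pi), r :=
    intervalIntegral.integral_congr fun x hx => by
      rw [uIcc_of_le Real.two_pi_pos.le] at hx
      simp only [(memH1_circleCurve r).2 hx, norm_circleVelocity hr.le]
  rw [curveLength, e]
  simp

theorem lineIntegral_circleCurve {r c : ℝ} (hr : 0 < r) {f : ℝ → ℝ} (hf : ∀ x ∈ I, f x = c) :
    lineIntegral (circleCurve r) f = c * (2 * Real.pi * r) := by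
  rw [← curveLength_circleCurve hr, curveLength, ← intervalIntegral.integral_const_mul]
  refine intervalIntegral.integral_congr fun x hx => ?_
  rw [uIcc_of_le Real.two_pi_pos.le] at hx
  simp only [hf x hx]

theorem energy_circleCurve (δ lam : ℝ) {r s : ℝ} (hr : 0 < r) :
    energy δ lam (circleCurve r) (circleCurve s) =
      (1 / 2 * (r⁻¹ + δ * (s / r)) ^ 2 + lam / 2 * (s / r) ^ 2 + 1) * (2 * Real.pi * r) := by
  rw [energy, lineIntegral_circleCurve (c := (r⁻¹ + δ * (s / r)) ^ 2) hr fun x hx => by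
      rw [curvature_circleCurve hr hx, divCurve_circleCurve hr hx],
    lineIntegral_circleCurve hr fun x hx => matNormSq_gradCurve_circleCurve hr hx,
    curveLength_circleCurve hr]
  ring

end LM

/-! ### The minimizing pair -/

theorem theorem3p3 (δ lam : ℝ) (hlam : 0 < lam) :
    ∃ γ η : ℝ → LM.Plane, LM.Admissible γ η ∧
      (∀ x ∈ LM.I, ‖LM.dx γ x‖ = LM.curveLength γ / (2 * Real.pi)) ∧
      ∀ γ' η' : ℝ → LM.Plane, LM.Admissible γ' η' →
        LM.energy δ lam γ η ≤ LM.energy δ lam γ' η' := by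
  have hpos : 0 < lam + δ ^ 2 := by positivity
  obtain ⟨R, hR, hR2⟩ : ∃ R : ℝ, 0 < R ∧ 2 * R ^ 2 * (lam + δ ^ 2) = lam := by
    refine ⟨√(lam / (2 * (lam + δ ^ 2))), by positivity, ?_⟩
    rw [Real.sq_sqrt (by positivity)]
    field_simp
  -- On the circle of radius R, κ = 1/R and a field `circleCurve s` has divergence s/R. The optimal
  -- value -δκ/(λ + δ²) forces s = -δ/(λ + δ²).
  refine ⟨LM.circleCurve R, LM.circleCurve (-δ / (lam + δ ^ 2)),
    ⟨LM.memH2imm_circleCurve hR, LM.memH1per_circleCurve _, LM.integral_circleCurve _,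
      LM.integral_circleCurve _⟩, fun x hx => ?_, fun γ' η' h => ?_⟩
  · rw [LM.curveLength_circleCurve hR, (LM.memH1_circleCurve R).2 hx,
      LM.norm_circleVelocity hR.le, mul_div_cancel_left₀ _ Real.two_pi_pos.ne']
  · refine le_trans (le_of_eq ?_) (LM.four_pi_radius_le_energy hlam hR hR2 h.1 h.2.1.1)
    -- For the optimal divergence this sum is R²κ², equal to 1 because κ = 1/R; this is the equality
    -- case of R²κ² + 1 ≥ 2R|κ|.
    have e : 1 / 2 * (R⁻¹ + δ * (-δ / (lam + δ ^ 2) / R)) ^ 2 +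
        lam / 2 * (-δ / (lam + δ ^ 2) / R) ^ 2 = 1 := by
      have h1 : 1 / 2 * (R⁻¹ + δ * (-δ / (lam + δ ^ 2) / R)) ^ 2 +
          lam / 2 * (-δ / (lam + δ ^ 2) / R) ^ 2 = lam / (2 * R ^ 2 * (lam + δ ^ 2)) := by
        field_simp
        ring
      rw [h1, hR2, div_self hlam.ne']
    rw [LM.energy_circleCurve δ lam hR, e]
    ring
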